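/- All C*-algebras are complex and not necessarily unital, and all morphisms are (not necessarily unital) $*$-homomorphisms. For a C*-algebra $F$ and $k\ge 1$ let $\mathbf I^kF=C([0,1]^k,F)$ and $\mathbf S^{k-1}F=C(\partial[0,1]^k,F)$, and let $\partial:\mathbf I^kF\to\mathbf S^{k-1}F$ be the restriction morphism. An NCCW complex of dimension $n$ is a sequence $\{A_0,\dots,A_n\}$ of C*-algebras such that $A_0$ is finite-dimensional and, for $1\le k\le n$, $$A_k=\mathbf I^kF_k\oplus_{\mathbf S^{k-1}F_k}A_{k-1}=\{(x,a)\in \mathbf I^kF_k\oplus A_{k-1} : \partial x=\sigma_k(a)\}$$ for some finite-dimensional C*-algebra $F_k$ and some morphism $\sigma_k:A_{k-1}\to\mathbf S^{k-1}F_k$. A C*-algebra $A$ admits an NCCW complex structure if $A\cong A_n$ for some NCCW complex $\{A_0,\dots,A_n\}$. For a morphism $f:A\to B$, the NC mapping cone $\mathrm{Cone}(f)$ is the pullback of $f\circ\mathrm{ev}(1): C_0((0,1])\otimes A\to B$ and $\mathrm{id}:B\to B$, that is, $$\mathrm{Cone}(f)=\{(x,b)\in (C_0((0,1])\otimes A)\oplus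 B : f(x(1))=b\},$$ where $C_0((0,1])\otimes A$ is identified with $C_0((0,1],A)$. Proposition. If $A$ and $B$ admit NCCW complex structures and $f:A\to B$ is a morphism, then $\mathrm{Cone}(f)$ admits an NCCW complex structure. -/

import Mathlib

open scoped ZeroAtInfty unitInterval CStarAlgebra

universe u

namespace NCCW

section Pullback

variable {A B C : Type*} [NonUnitalCStarAlgebra A] [NonUnitalCStarAlgebra B]
  [NonUnitalCStarAlgebra C]

/-- The pullback of C*-algebras `A ⊕_C B = {(a, b) ∈ A ⊕ B : α a = β b}` along two
*-homomorphisms `α : A → C` and `β : B → C`. -/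
def pullback (α : A →⋆ₙₐ[ℂ] C) (β : B →⋆ₙₐ[ℂ] C) : NonUnitalStarSubalgebra ℂ (A × B) :=
  NonUnitalStarAlgHom.equalizer (α.comp (NonUnitalStarAlgHom.fst ℂ A B))
    (β.comp (NonUnitalStarAlgHom.snd ℂ A B))

theorem mem_pullback (α : A →⋆ₙₐ[ℂ] C) (β : B →⋆ₙₐ[ℂ] C) (x : A × B) :
    x ∈ pullback α β ↔ α x.1 = β x.2 :=
  Iff.rfl

instance isClosed_pullback (α : A →⋆ₙₐ[ℂ] C) (β : B →⋆ₙₐ[ℂ] C) :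
    IsClosed (pullback α β : Set (A × B)) :=
  isClosed_eq
    ((map_continuous α).comp continuous_fst)
    ((map_continuous β).comp continuous_snd)

end Pullback

section Complexes

theorem isClosed_boundary (k : ℕ) : IsClosed (Cube.boundary (Fin k)) := by
  have h : Cube.boundary (Fin k) = ⋃ i : Fin k, {y : Fin k → I | y i = 0 ∨ y i = 1} := by
    ext y
    simp [Cube.boundary]
  rw [h]
  exact isClosed_iUnion_of_finite fun i =>
    (isClosed_eq (continuous_apply i) continuous_const).union
      (isClosed_eq (continuous_apply i) continuous_const)

instance compactSpace_boundary (k : ℕ) : CompactSpace (Cube.boundary (Fin k)) :=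
  isCompact_iff_compactSpace.mp (isClosed_boundary k).isCompact

/-- `I^k F = C([0,1]^k, F)`. -/
abbrev CubeAlg (k : ℕ) (F : Type*) [NonUnitalCStarAlgebra F] : Type _ :=
  C(Fin k → I, F)

/-- `S^{k-1} F = C(S^{k-1}, F)`, where the sphere `S^{k-1}` is realised as the boundary of the
cube `[0,1]^k`. -/
abbrev SphereAlg (k : ℕ) (F : Type*) [NonUnitalCStarAlgebra F] : Type _ :=
  C(Cube.boundary (Fin k), F)

/-- The restriction morphism `∂ : I^k F → S^{k-1} F`. -/
def restrictBoundary (k : ℕ) (F : Type*) [NonUnitalCStarAlgebra F] :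
    CubeAlg k F →⋆ₙₐ[ℂ] SphereAlg k F where
  toFun x := x.restrict (Cube.boundary (Fin k))
  map_smul' _ _ := rfl
  map_zero' := rfl
  map_add' _ _ := rfl
  map_mul' _ _ := rfl
  map_star' _ := rfl

/-- `IsComplex n A` : the C*-algebra `A` is (*-isomorphic to) the last term `A_n` of an NCCW
complex `{A_0, …, A_n}`.  Here `A_0` is a C*-algebra of finite linear dimension, and for
`1 ≤ k ≤ n` one has `A_k = I^k F_k ⊕_{S^{k-1} F_k} A_{k-1}`, the pullback of the restriction
morphism `∂ : I^k F_k → S^{k-1} F_k` and of a *-homomorphism `σ_k : A_{k-1} → S^{k-1} F_k`, where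
`F_k` is a C*-algebra of finite linear dimension. -/
def IsComplex : ℕ → ∀ (A : Type u) [NonUnitalCStarAlgebra A], Prop
  | 0, A, _ => FiniteDimensional ℂ A
  | n + 1, A, _ =>
    ∃ (A' : Type u) (_ : NonUnitalCStarAlgebra A') (F : Type u) (_ : NonUnitalCStarAlgebra F)
      (s : A' →⋆ₙₐ[ℂ] SphereAlg (n + 1) F),
      IsComplex n A' ∧ FiniteDimensional ℂ F ∧
        Nonempty (A ≃⋆ₐ[ℂ] pullback (restrictBoundary (n + 1) F) s)

/-- `A` admits an NCCW complex structure. -/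
def AdmitsNCCW (A : Type u) [NonUnitalCStarAlgebra A] : Prop :=
  ∃ n : ℕ, IsComplex n A

end Complexes

section MappingCone

/-- The NC cone `C_0((0,1]) ⊗ A`, realised as `C_0((0,1], A)`. -/
abbrev Cone (A : Type*) [NonUnitalCStarAlgebra A] : Type _ :=
  C₀(Set.Ioc (0 : ℝ) 1, A)

/-- Evaluation at the point `1`, as a *-homomorphism `C_0((0,1]) ⊗ A → A`. -/
def Cone.evalOne (A : Type*) [NonUnitalCStarAlgebra A] : Cone A →⋆ₙₐ[ℂ] A where
  toFun x := x ⟨1, zero_lt_one, le_rfl⟩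
  map_smul' _ _ := rfl
  map_zero' := rfl
  map_add' _ _ := rfl
  map_mul' _ _ := rfl
  map_star' _ := rfl

/-- The NC mapping cone of a *-homomorphism `f : A → B`: the pullback of
`f ∘ ev(1) : C_0((0,1]) ⊗ A → B` and `id : B → B`. -/
abbrev MappingCone {A B : Type*} [NonUnitalCStarAlgebra A] [NonUnitalCStarAlgebra B]
    (f : A →⋆ₙₐ[ℂ] B) : Type _ :=
  pullback (f.comp (Cone.evalOne A)) (NonUnitalStarAlgHom.id ℂ B)

end MappingCone

end NCCW

/-!
In `MappingCone f` the second coordinate `b = f (x 1)` is determined by `x`, so the mapping cone is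
isomorphic to the cone `C₀((0,1], A)` (`nonempty_mappingCone_equiv_cone`). It remains to see that
the cone over an NCCW complex of dimension `n` is an NCCW complex of dimension `n + 1`.

If `A` is obtained from `A'` by attaching a `k`-cell `C([0,1]^k, G)` along `s`, an element of the
cone over `A` consists of an element `y` of the cone over `A'` and a function on the cylinder
`[0,1] × [0,1]^k` that is prescribed on the wall `[0,1] × ∂[0,1]^k` by `s (y t)`, vanishes on the
bottom, and is an arbitrary compatible `u` on the lid. The pairs `(u, y)` form the algebra
`ConeWithCell s`, and the cylinder is a `(k + 1)`-cell attached to it by `glue s`; this is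
`coneEquivPullback`. Moreover evaluation at `1` factors through `ConeWithCell s`.

The algebra `ConeWithCell s` is itself obtained from the cone over `A'` by attaching a `k`-cell.
With `k = n + 1`, the induction hypothesis says that the cone over `A'` arises from a complex `E`
of dimension `n` by attaching cells of that same dimension `n + 1`, and that evaluation at `1`
factors through `E`. The new cell, which is attached by `s` composed with evaluation at `1`, is
therefore attached to `E` as well, and both families of cells form a single one
(`nonempty_pullback_equiv_sphereProd`). The induction starts with `k = 0` and `A' = 0`.
-/

namespace NCCW

open Filter Topology

/-! ### Cones as functions on the closed interval -/

section Cone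

/-- The inclusion of `(0,1]` in `[0,1]`. -/
def iocIncl (t : Set.Ioc (0 : ℝ) 1) : I :=
  ⟨t, t.2.1.le, t.2.2⟩

theorem isEmbedding_iocIncl : IsEmbedding iocIncl :=
  IsEmbedding.subtypeVal.of_comp (by unfold iocIncl; fun_prop) continuous_subtype_val

theorem range_iocIncl : Set.range iocIncl = {0}ᶜ := by
  ext t
  constructor
  · rintro ⟨t, rfl⟩ h
    exact t.2.1.ne' (congrArg Subtype.val h)
  · intro h
    exact ⟨⟨t, unitInterval.pos_iff_ne_zero.2 h, t.2.2⟩, rfl⟩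

theorem cocompact_eq_comap_iocIncl :
    cocompact (Set.Ioc (0 : ℝ) 1) = comap iocIncl (𝓝 0) := by
  ext s
  rw [mem_cocompact', mem_comap]
  constructor
  · rintro ⟨K, hK, hs⟩
    refine ⟨(iocIncl '' K)ᶜ,
      (hK.image isEmbedding_iocIncl.continuous).isClosed.isOpen_compl.mem_nhds ?_, ?_⟩
    · rintro ⟨t, -, ht⟩
      exact (range_iocIncl ▸ Set.mem_range_self t : iocIncl t ∈ ({0}ᶜ : Set I)) ht
    · intro t ht
      by_contra hts
      exact ht ⟨t, hs hts, rfl⟩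
  · rintro ⟨U, hU, hs⟩
    obtain ⟨V, hVU, hV, h0⟩ := mem_nhds_iff.1 hU
    refine ⟨iocIncl ⁻¹' Vᶜ, (isEmbedding_iocIncl.isInducing.isCompact_preimage_iff ?_).2
      hV.isClosed_compl.isCompact, ?_⟩
    · rw [range_iocIncl]
      rintro t ht rfl
      exact ht h0
    · intro t ht hV'
      exact ht (hs (hVU hV'))

variable {A B : Type*} [NonUnitalCStarAlgebra A] [NonUnitalCStarAlgebra B]

open Classical in
/-- Extension of an element of the cone by `0` at the apex. -/
noncomputable def coneExtendFun (x : Cone A) (t : I) : A :=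
  if h : 0 < (t : ℝ) then x ⟨t, h, t.2.2⟩ else 0

theorem coneExtendFun_zero (x : Cone A) : coneExtendFun x 0 = 0 := by
  simp [coneExtendFun]

theorem coneExtendFun_iocIncl (x : Cone A) (t : Set.Ioc (0 : ℝ) 1) :
    coneExtendFun x (iocIncl t) = x t :=
  dif_pos t.2.1

theorem continuous_coneExtendFun (x : Cone A) : Continuous (coneExtendFun x) := by
  have hcomp : coneExtendFun x ∘ iocIncl = x := funext (coneExtendFun_iocIncl x)
  rw [continuous_iff_continuousAt]
  intro t
  by_cases ht : t = 0
  · subst ht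
    rw [continuousAt_iff_punctured_nhds, coneExtendFun_zero, ← range_iocIncl,
      nhdsWithin, ← map_comap, tendsto_map'_iff, hcomp, ← cocompact_eq_comap_iocIncl]
    exact x.zero_at_infty'
  · obtain ⟨t, rfl⟩ : t ∈ Set.range iocIncl := by rw [range_iocIncl]; exact ht
    have hemb : IsOpenEmbedding iocIncl :=
      ⟨isEmbedding_iocIncl, by rw [range_iocIncl]; exact isOpen_compl_singleton⟩
    rw [← hemb.continuousAt_iff, hcomp]
    exact x.continuous.continuousAt

/-- The inclusion of `C₀((0,1], A)` in `C([0,1], A)`, extending functions by `0`. -/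
noncomputable def coneExtend (A : Type*) [NonUnitalCStarAlgebra A] :
    Cone A →⋆ₙₐ[ℂ] C(I, A) where
  toFun x := ⟨coneExtendFun x, continuous_coneExtendFun x⟩
  map_smul' c x := by
    ext t
    change coneExtendFun (c • x) t = c • coneExtendFun x t
    unfold coneExtendFun; split_ifs <;> simp
  map_zero' := by
    ext t
    change coneExtendFun (0 : Cone A) t = 0
    unfold coneExtendFun; split_ifs <;> simp
  map_add' x y := by
    ext t
    change coneExtendFun (x + y) t = coneExtendFun x t + coneExtendFun y t
    unfold coneExtendFun; split_ifs <;> simp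
  map_mul' x y := by
    ext t
    change coneExtendFun (x * y) t = coneExtendFun x t * coneExtendFun y t
    unfold coneExtendFun; split_ifs <;> simp
  map_star' x := by
    ext t
    change coneExtendFun (star x) t = star (coneExtendFun x t)
    unfold coneExtendFun; split_ifs <;> simp

@[simp]
theorem coneExtend_zero (x : Cone A) : coneExtend A x 0 = 0 :=
  coneExtendFun_zero x

theorem coneExtend_iocIncl (x : Cone A) (t : Set.Ioc (0 : ℝ) 1) :
    coneExtend A x (iocIncl t) = x t :=
  coneExtendFun_iocIncl x t

theorem coneExtend_one (x : Cone A) : coneExtend A x 1 = Cone.evalOne A x :=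
  coneExtend_iocIncl x ⟨1, zero_lt_one, le_rfl⟩

theorem coneExtend_injective : Function.Injective (coneExtend A) := by
  intro x y h
  ext t
  rw [← coneExtend_iocIncl, h, coneExtend_iocIncl]

theorem exists_coneExtend_eq (g : C(I, A)) (hg : g 0 = 0) : ∃ x, coneExtend A x = g := by
  refine ⟨⟨g.comp ⟨iocIncl, isEmbedding_iocIncl.continuous⟩, ?_⟩, ?_⟩
  · rw [cocompact_eq_comap_iocIncl]
    have h := (g.continuous.tendsto 0).comp (tendsto_comap (f := iocIncl) (x := 𝓝 0))
    rwa [hg] at h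
  · ext t
    by_cases ht : t = 0
    · rw [ht, coneExtend_zero, hg]
    · obtain ⟨t, rfl⟩ : t ∈ Set.range iocIncl := by rw [range_iocIncl]; exact ht
      exact coneExtend_iocIncl _ t

/-- The morphism of cones induced by a morphism of C*-algebras. -/
def coneMap (f : A →⋆ₙₐ[ℂ] B) : Cone A →⋆ₙₐ[ℂ] Cone B where
  toFun x := ⟨⟨fun t => f (x t), (map_continuous f).comp x.continuous⟩, by
    have h := ((map_continuous f).tendsto 0).comp x.zero_at_infty'
    rwa [map_zero] at h⟩
  map_smul' c x := by ext t; exact map_smul f c (x t)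
  map_zero' := by ext t; exact map_zero f
  map_add' x y := by ext t; exact map_add f (x t) (y t)
  map_mul' x y := by ext t; exact map_mul f (x t) (y t)
  map_star' x := by ext t; exact map_star f (x t)

theorem coneExtend_coneMap (f : A →⋆ₙₐ[ℂ] B) (x : Cone A) (t : I) :
    coneExtend B (coneMap f x) t = f (coneExtend A x t) := by
  by_cases ht : t = 0
  · rw [ht, coneExtend_zero, coneExtend_zero, map_zero]
  · obtain ⟨t, rfl⟩ : t ∈ Set.range iocIncl := by rw [range_iocIncl]; exact ht
    rw [coneExtend_iocIncl, coneExtend_iocIncl]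
    rfl

end Cone

/-! ### The cone over a pullback along a cell -/

section Gluing

variable {k : ℕ} {A A' G : Type*} [NonUnitalCStarAlgebra A] [NonUnitalCStarAlgebra A']
  [NonUnitalCStarAlgebra G]

theorem mem_boundary_succ_iff {v : Fin (k + 1) → I} :
    v ∈ Cube.boundary (Fin (k + 1)) ↔
      (v 0 = 0 ∨ v 0 = 1) ∨ Fin.tail v ∈ Cube.boundary (Fin k) :=
  Fin.exists_fin_succ

theorem mem_pullback_restrictBoundary (s : A →⋆ₙₐ[ℂ] SphereAlg k G) (p : CubeAlg k G × A) :
    p ∈ pullback (restrictBoundary k G) s ↔ ∀ z : Cube.boundary (Fin k), p.1 z = s p.2 z :=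
  DFunLike.ext_iff

/-- The functions on the cylinder `[0,1] × [0,1]^k` obtained from `C([0,1]^k, G)`-valued
functions on the cone. -/
noncomputable def coneCube (p : A →⋆ₙₐ[ℂ] CubeAlg k G) : Cone A →⋆ₙₐ[ℂ] CubeAlg (k + 1) G where
  toFun x := ⟨fun v => p (coneExtend A x (v 0)) (Fin.tail v), by
    have h : Continuous fun v : Fin (k + 1) → I => p (coneExtend A x (v 0)) :=
      (map_continuous p).comp ((coneExtend A x).continuous.comp (continuous_apply 0))
    unfold Fin.tail
    fun_prop⟩
  map_smul' c x := by ext v; simp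
  map_zero' := by ext v; simp
  map_add' x y := by ext v; simp
  map_mul' x y := by ext v; simp
  map_star' x := by ext v; simp [map_star]

/-- The algebra `{(u, y) ∈ C([0,1]^k, G) ⊕ C₀((0,1], A') : ∂u = s(y(1))}`, which consists of the
cone over `A'` together with the `k`-cell attached by `s` at the end `1` of the cone. -/
abbrev ConeWithCell (s : A' →⋆ₙₐ[ℂ] SphereAlg k G) : Type _ :=
  pullback (restrictBoundary k G) (s.comp (Cone.evalOne A'))

variable (s : A' →⋆ₙₐ[ℂ] SphereAlg k G)

open Classical in
/-- The function on the boundary of `[0,1] × [0,1]^k` which is `s(y(t))` on the wall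
`{t} × ∂[0,1]^k`, `u` on the lid `{1} × [0,1]^k`, and `0` on the bottom `{0} × [0,1]^k`. -/
noncomputable def glueFun (p : ConeWithCell s) (v : Cube.boundary (Fin (k + 1))) : G :=
  if h : Fin.tail v.1 ∈ Cube.boundary (Fin k) then
    s (coneExtend A' p.1.2 (v.1 0)) ⟨Fin.tail v.1, h⟩
  else if v.1 0 = 1 then p.1.1 (Fin.tail v.1) else 0

variable {s}

theorem glueFun_wall (p : ConeWithCell s) {v : Cube.boundary (Fin (k + 1))}
    (h : Fin.tail v.1 ∈ Cube.boundary (Fin k)) :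
    glueFun s p v = s (coneExtend A' p.1.2 (v.1 0)) ⟨Fin.tail v.1, h⟩ :=
  dif_pos h

theorem glueFun_lid (p : ConeWithCell s) {v : Cube.boundary (Fin (k + 1))} (h : v.1 0 = 1) :
    glueFun s p v = p.1.1 (Fin.tail v.1) := by
  by_cases hv : Fin.tail v.1 ∈ Cube.boundary (Fin k)
  · rw [glueFun_wall p hv, h, coneExtend_one]
    exact ((mem_pullback_restrictBoundary _ _).1 p.2 ⟨_, hv⟩).symm
  · rw [glueFun, dif_neg hv, if_pos h]

theorem glueFun_bottom (p : ConeWithCell s) {v : Cube.boundary (Fin (k + 1))} (h : v.1 0 = 0) :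
    glueFun s p v = 0 := by
  by_cases hv : Fin.tail v.1 ∈ Cube.boundary (Fin k)
  · rw [glueFun_wall p hv, h, coneExtend_zero, map_zero]
    rfl
  · rw [glueFun, dif_neg hv, if_neg (by simp [h])]

theorem continuous_glueFun (p : ConeWithCell s) : Continuous (glueFun s p) := by
  have htail : Continuous fun v : Cube.boundary (Fin (k + 1)) => Fin.tail v.1 :=
    continuous_pi fun i => (continuous_apply i.succ).comp continuous_subtype_val
  have hzero : Continuous fun v : Cube.boundary (Fin (k + 1)) => v.1 0 :=
    (continuous_apply 0).comp continuous_subtype_val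
  have hends : IsClosed {v : Cube.boundary (Fin (k + 1)) | v.1 0 = 0 ∨ v.1 0 = 1} :=
    (isClosed_eq hzero continuous_const).union (isClosed_eq hzero continuous_const)
  have hwall : IsClosed {v : Cube.boundary (Fin (k + 1)) | Fin.tail v.1 ∈ Cube.boundary (Fin k)} :=
    (isClosed_boundary k).preimage htail
  have huniv : {v : Cube.boundary (Fin (k + 1)) | v.1 0 = 0 ∨ v.1 0 = 1} ∪
      {v | Fin.tail v.1 ∈ Cube.boundary (Fin k)} = Set.univ :=
    Set.eq_univ_of_forall fun v => mem_boundary_succ_iff.1 v.2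
  rw [← continuousOn_univ, ← huniv]
  refine ContinuousOn.union_of_isClosed ?_ ?_ hends hwall
  · refine ContinuousOn.union_of_isClosed ?_ ?_ (isClosed_eq hzero continuous_const)
      (isClosed_eq hzero continuous_const)
    · exact continuousOn_const.congr fun v hv => glueFun_bottom p hv
    · exact (p.1.1.continuous.comp htail).continuousOn.congr fun v hv => glueFun_lid p hv
  · rw [continuousOn_iff_continuous_domRestrict]
    have h1 : Continuous fun v : {v : Cube.boundary (Fin (k + 1)) |
        Fin.tail v.1 ∈ Cube.boundary (Fin k)} => s (coneExtend A' p.1.2 (v.1.1 0)) :=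
      (map_continuous s).comp ((coneExtend A' p.1.2).continuous.comp
        (hzero.comp continuous_subtype_val))
    have h2 : Continuous fun v : {v : Cube.boundary (Fin (k + 1)) |
        Fin.tail v.1 ∈ Cube.boundary (Fin k)} =>
          (⟨Fin.tail v.1.1, v.2⟩ : Cube.boundary (Fin k)) :=
      (htail.comp continuous_subtype_val).subtype_mk _
    refine (continuous_eval.comp (h1.prodMk h2)).congr fun v => ?_
    exact (glueFun_wall p v.2).symm

variable (s)

/-- The attaching morphism of the `(k+1)`-cell in the cone over a pullback along a `k`-cell. -/
noncomputable def glue : ConeWithCell s →⋆ₙₐ[ℂ] SphereAlg (k + 1) G where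
  toFun p := ⟨glueFun s p, continuous_glueFun p⟩
  map_smul' c p := by
    ext v
    change glueFun s (c • p) v = c • glueFun s p v
    unfold glueFun; split_ifs <;> simp
  map_zero' := by
    ext v
    change glueFun s 0 v = 0
    unfold glueFun; split_ifs <;> simp
  map_add' p q := by
    ext v
    change glueFun s (p + q) v = glueFun s p v + glueFun s q v
    unfold glueFun; split_ifs <;> simp
  map_mul' p q := by
    ext v
    change glueFun s (p * q) v = glueFun s p v * glueFun s q v
    unfold glueFun; split_ifs <;> simp
  map_star' p := by
    ext v
    change glueFun s (star p) v = star (glueFun s p v)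
    unfold glueFun; split_ifs <;> simp [map_star]

variable {s}

/-- The first coordinate on an algebra identified with a pullback. -/
noncomputable def toFst (e : A ≃⋆ₐ[ℂ] pullback (restrictBoundary k G) s) : A →⋆ₙₐ[ℂ] CubeAlg k G :=
  (NonUnitalStarAlgHom.fst ℂ _ _).comp
    ((NonUnitalStarSubalgebraClass.subtype (pullback (restrictBoundary k G) s)).comp
      (e : A →⋆ₙₐ[ℂ] pullback (restrictBoundary k G) s))

/-- The second coordinate on an algebra identified with a pullback. -/
noncomputable def toSnd (e : A ≃⋆ₐ[ℂ] pullback (restrictBoundary k G) s) : A →⋆ₙₐ[ℂ] A' :=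
  (NonUnitalStarAlgHom.snd ℂ _ _).comp
    ((NonUnitalStarSubalgebraClass.subtype (pullback (restrictBoundary k G) s)).comp
      (e : A →⋆ₙₐ[ℂ] pullback (restrictBoundary k G) s))

theorem toFst_boundary (e : A ≃⋆ₐ[ℂ] pullback (restrictBoundary k G) s) (a : A)
    (z : Cube.boundary (Fin k)) : toFst e a z = s (toSnd e a) z :=
  (mem_pullback_restrictBoundary _ _).1 (e a).2 z

theorem eq_of_toFst_of_toSnd (e : A ≃⋆ₐ[ℂ] pullback (restrictBoundary k G) s) {a b : A}
    (h1 : toFst e a = toFst e b) (h2 : toSnd e a = toSnd e b) : a = b :=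
  e.injective (Subtype.ext (Prod.ext h1 h2))

/-- Restriction of an element of the cone over `A` to its `k`-cell at the end `1` and to the
cone over `A'`. -/
noncomputable def coneToConeWithCell (e : A ≃⋆ₐ[ℂ] pullback (restrictBoundary k G) s) :
    Cone A →⋆ₙₐ[ℂ] ConeWithCell s :=
  NonUnitalStarAlgHom.codRestrict
    (((toFst e).comp (Cone.evalOne A)).prod (coneMap (toSnd e))) _ fun _ =>
      (mem_pullback_restrictBoundary _ _).2 fun z => toFst_boundary e _ z

/-- The endpoint at `1`, as a morphism to `A`. -/
noncomputable def coneWithCellEval (e : A ≃⋆ₐ[ℂ] pullback (restrictBoundary k G) s) :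
    ConeWithCell s →⋆ₙₐ[ℂ] A :=
  (e.symm : pullback (restrictBoundary k G) s →⋆ₙₐ[ℂ] A).comp
    (NonUnitalStarAlgHom.codRestrict
      (((NonUnitalStarAlgHom.fst ℂ _ _).prod
        ((Cone.evalOne A').comp (NonUnitalStarAlgHom.snd ℂ _ _))).comp
        (NonUnitalStarSubalgebraClass.subtype
          (pullback (restrictBoundary k G) (s.comp (Cone.evalOne A'))))) _ fun p => p.2)

theorem coneWithCellEval_coneToConeWithCell (e : A ≃⋆ₐ[ℂ] pullback (restrictBoundary k G) s)
    (x : Cone A) : coneWithCellEval e (coneToConeWithCell e x) = Cone.evalOne A x :=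
  e.symm_apply_apply _

/-- The morphism from the cone over `A` to the algebra obtained by attaching to `ConeWithCell s`
the product of the cell of `A` with `[0,1]`. -/
noncomputable def coneToPullback (e : A ≃⋆ₐ[ℂ] pullback (restrictBoundary k G) s) :
    Cone A →⋆ₙₐ[ℂ] pullback (restrictBoundary (k + 1) G) (glue s) :=
  NonUnitalStarAlgHom.codRestrict ((coneCube (toFst e)).prod (coneToConeWithCell e)) _ fun x =>
    (mem_pullback_restrictBoundary _ _).2 fun v => by
      change toFst e (coneExtend A x (v.1 0)) (Fin.tail v.1) = glueFun s (coneToConeWithCell e x) v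
      rcases mem_boundary_succ_iff.1 v.2 with (h | h) | h
      · rw [glueFun_bottom _ h, h, coneExtend_zero, map_zero]
        rfl
      · rw [glueFun_lid _ h, h, coneExtend_one]
        rfl
      · rw [glueFun_wall _ h, toFst_boundary e _ ⟨_, h⟩]
        exact congrArg (fun b => s b ⟨_, h⟩) (coneExtend_coneMap (toSnd e) x _).symm

theorem coneToPullback_bijective (e : A ≃⋆ₐ[ℂ] pullback (restrictBoundary k G) s) :
    Function.Bijective (coneToPullback e) := by
  constructor
  · intro x y h
    have h1 : coneCube (toFst e) x = coneCube (toFst e) y := congrArg (fun p => p.1.1) h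
    have h2 : coneMap (toSnd e) x = coneMap (toSnd e) y := congrArg (fun p => p.1.2.1.2) h
    refine coneExtend_injective (ContinuousMap.ext fun t => eq_of_toFst_of_toSnd e ?_ ?_)
    · ext z
      exact DFunLike.congr_fun h1 (Fin.cons t z)
    · rw [← coneExtend_coneMap, h2, coneExtend_coneMap]
  · rintro ⟨⟨w, p⟩, hwp⟩
    have hw : ∀ v : Cube.boundary (Fin (k + 1)), w v = glueFun s p v :=
      (mem_pullback_restrictBoundary _ _).1 hwp
    -- The slice of `w` at height `t` and the value of the cone over `A'` at `t` define a point
    -- of the pullback, hence of `A`.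
    let W : C(I, CubeAlg k G) := ContinuousMap.curry
      ⟨fun q : I × (Fin k → I) => w (Fin.cons q.1 q.2),
        w.continuous.comp (Continuous.finCons (A := fun _ => I) continuous_fst continuous_snd)⟩
    have hW : ∀ t, (W t, coneExtend A' p.1.2 t) ∈ pullback (restrictBoundary k G) s := by
      intro t
      rw [mem_pullback_restrictBoundary]
      intro z
      have hz : (Fin.cons t z.1 : Fin (k + 1) → I) ∈ Cube.boundary (Fin (k + 1)) :=
        mem_boundary_succ_iff.2 (Or.inr z.2)
      exact (hw ⟨_, hz⟩).trans (glueFun_wall p (v := ⟨_, hz⟩) z.2)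
    let g : C(I, A) := ⟨fun t => e.symm ⟨_, hW t⟩,
      (map_continuous (e.symm : pullback (restrictBoundary k G) s →⋆ₙₐ[ℂ] A)).comp
        ((W.continuous.prodMk (coneExtend A' p.1.2).continuous).subtype_mk hW)⟩
    have hg1 : ∀ t, toFst e (g t) = W t := fun t =>
      congrArg (fun q => q.1.1) (e.apply_symm_apply ⟨_, hW t⟩)
    have hg2 : ∀ t, toSnd e (g t) = coneExtend A' p.1.2 t := fun t =>
      congrArg (fun q => q.1.2) (e.apply_symm_apply ⟨_, hW t⟩)
    have hg0 : g 0 = 0 := by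
      refine eq_of_toFst_of_toSnd e ?_ ?_
      · rw [hg1, map_zero (toFst e)]
        ext z
        have hz : (Fin.cons 0 z : Fin (k + 1) → I) ∈ Cube.boundary (Fin (k + 1)) :=
          mem_boundary_succ_iff.2 (Or.inl (Or.inl rfl))
        exact (hw ⟨_, hz⟩).trans (glueFun_bottom p (v := ⟨_, hz⟩) rfl)
      · rw [hg2, map_zero (toSnd e), coneExtend_zero]
    obtain ⟨x, hx⟩ := exists_coneExtend_eq g hg0
    refine ⟨x, Subtype.ext (Prod.ext ?_ (Subtype.ext (Prod.ext ?_ ?_)))⟩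
    · ext v
      change toFst e (coneExtend A x (v 0)) (Fin.tail v) = w v
      rw [hx, hg1]
      exact congrArg w (Fin.cons_self_tail v)
    · change toFst e (Cone.evalOne A x) = p.1.1
      rw [← coneExtend_one, hx, hg1]
      ext z
      have hz : (Fin.cons 1 z : Fin (k + 1) → I) ∈ Cube.boundary (Fin (k + 1)) :=
        mem_boundary_succ_iff.2 (Or.inl (Or.inr rfl))
      exact (hw ⟨_, hz⟩).trans (glueFun_lid p (v := ⟨_, hz⟩) rfl)
    · change coneMap (toSnd e) x = p.1.2
      refine coneExtend_injective (ContinuousMap.ext fun t => ?_)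
      rw [coneExtend_coneMap, hx, hg2]

/-- The cone over a pullback along a `k`-cell is a pullback along a `(k+1)`-cell. -/
noncomputable def coneEquivPullback (e : A ≃⋆ₐ[ℂ] pullback (restrictBoundary k G) s) :
    Cone A ≃⋆ₐ[ℂ] pullback (restrictBoundary (k + 1) G) (glue s) :=
  StarAlgEquiv.ofBijective (coneToPullback e) (coneToPullback_bijective e)

end Gluing

/-! ### Induction over the skeleta -/

section Attach

variable {k : ℕ} {C D E F G : Type*} [NonUnitalCStarAlgebra C] [NonUnitalCStarAlgebra D]
  [NonUnitalCStarAlgebra E] [NonUnitalCStarAlgebra F] [NonUnitalCStarAlgebra G]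

/-- The morphism to the sphere algebra of a direct sum with given components. -/
noncomputable def sphereProd (r : E →⋆ₙₐ[ℂ] SphereAlg k F) (t : E →⋆ₙₐ[ℂ] SphereAlg k G) :
    E →⋆ₙₐ[ℂ] SphereAlg k (F × G) where
  toFun x := (r x).prodMk (t x)
  map_smul' c x := by ext z <;> simp
  map_zero' := by ext z <;> simp
  map_add' x y := by ext z <;> simp
  map_mul' x y := by ext z <;> simp
  map_star' x := by ext z <;> simp [map_star]

/-- The morphism to the cube algebra of a direct sum with given components. -/
noncomputable def cubeProd (r : E →⋆ₙₐ[ℂ] CubeAlg k F) (t : E →⋆ₙₐ[ℂ] CubeAlg k G) :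
    E →⋆ₙₐ[ℂ] CubeAlg k (F × G) where
  toFun x := (r x).prodMk (t x)
  map_smul' c x := by ext z <;> simp
  map_zero' := by ext z <;> simp
  map_add' x y := by ext z <;> simp
  map_mul' x y := by ext z <;> simp
  map_star' x := by ext z <;> simp [map_star]

/-- Two families of `k`-cells, the second of which is attached through `C` to the algebra `E`
that carries the first, can be attached to `E` simultaneously. -/
theorem nonempty_pullback_equiv_sphereProd {r : E →⋆ₙₐ[ℂ] SphereAlg k F}
    (φ : C ≃⋆ₐ[ℂ] pullback (restrictBoundary k F) r) (t : E →⋆ₙₐ[ℂ] SphereAlg k G)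
    (t' : C →⋆ₙₐ[ℂ] SphereAlg k G) (ht : ∀ c, t' c = t (toSnd φ c)) :
    Nonempty (pullback (restrictBoundary k G) t' ≃⋆ₐ[ℂ]
      pullback (restrictBoundary k (F × G)) (sphereProd r t)) := by
  let π₁ : pullback (restrictBoundary k G) t' →⋆ₙₐ[ℂ] CubeAlg k G :=
    (NonUnitalStarAlgHom.fst ℂ _ _).comp
      (NonUnitalStarSubalgebraClass.subtype (pullback (restrictBoundary k G) t'))
  let π₂ : pullback (restrictBoundary k G) t' →⋆ₙₐ[ℂ] C :=
    (NonUnitalStarAlgHom.snd ℂ _ _).comp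
      (NonUnitalStarSubalgebraClass.subtype (pullback (restrictBoundary k G) t'))
  let Φ : pullback (restrictBoundary k G) t' →⋆ₙₐ[ℂ]
      pullback (restrictBoundary k (F × G)) (sphereProd r t) :=
    NonUnitalStarAlgHom.codRestrict
      ((cubeProd ((toFst φ).comp π₂) π₁).prod ((toSnd φ).comp π₂)) _ fun p =>
        (mem_pullback_restrictBoundary _ _).2 fun z =>
          Prod.ext (toFst_boundary φ _ z)
            (((mem_pullback_restrictBoundary _ _).1 p.2 z).trans
              (congrArg (fun a => a z) (ht p.1.2)))
  refine ⟨StarAlgEquiv.ofBijective Φ ⟨fun p q h => ?_, ?_⟩⟩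
  · have h1 : cubeProd ((toFst φ).comp π₂) π₁ p = cubeProd ((toFst φ).comp π₂) π₁ q :=
      congrArg (fun x => x.1.1) h
    have h2 : toSnd φ p.1.2 = toSnd φ q.1.2 := congrArg (fun x => x.1.2) h
    refine Subtype.ext (Prod.ext ?_ (eq_of_toFst_of_toSnd φ ?_ h2))
    · ext z
      exact congrArg Prod.snd (DFunLike.congr_fun h1 z)
    · ext z
      exact congrArg Prod.fst (DFunLike.congr_fun h1 z)
  · rintro ⟨⟨w, x⟩, hwx⟩
    have hw := (mem_pullback_restrictBoundary _ _).1 hwx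
    let w₁ : CubeAlg k F := ⟨fun z => (w z).1, continuous_fst.comp w.continuous⟩
    let w₂ : CubeAlg k G := ⟨fun z => (w z).2, continuous_snd.comp w.continuous⟩
    have h₁ : (w₁, x) ∈ pullback (restrictBoundary k F) r :=
      (mem_pullback_restrictBoundary _ _).2 fun z => congrArg Prod.fst (hw z)
    obtain ⟨c, hc⟩ := φ.surjective ⟨_, h₁⟩
    have hc₁ : toFst φ c = w₁ := congrArg (fun q => q.1.1) hc
    have hc₂ : toSnd φ c = x := congrArg (fun q => q.1.2) hc
    have h₂ : (w₂, c) ∈ pullback (restrictBoundary k G) t' :=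
      (mem_pullback_restrictBoundary _ _).2 fun z => by
        rw [ht, hc₂]
        exact congrArg Prod.snd (hw z)
    refine ⟨⟨_, h₂⟩, Subtype.ext (Prod.ext ?_ hc₂)⟩
    ext z
    · exact DFunLike.congr_fun hc₁ z
    · rfl

end Attach

/-- A finite-dimensional C*-algebra is obtained by attaching `0`-cells to the zero algebra, which
is here the algebra of functions on the empty type. -/
theorem nonempty_equiv_pullback_zero (A : Type u) [NonUnitalCStarAlgebra A] :
    Nonempty (A ≃⋆ₐ[ℂ] pullback (restrictBoundary 0 A)
      (0 : C(PEmpty.{u + 1}, A) →⋆ₙₐ[ℂ] SphereAlg 0 A)) := by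
  let κ : A →⋆ₙₐ[ℂ] CubeAlg 0 A :=
    { toFun a := .const _ a
      map_smul' _ _ := rfl
      map_zero' := rfl
      map_add' _ _ := rfl
      map_mul' _ _ := rfl
      map_star' _ := rfl }
  let Φ : A →⋆ₙₐ[ℂ] pullback (restrictBoundary 0 A)
      (0 : C(PEmpty.{u + 1}, A) →⋆ₙₐ[ℂ] SphereAlg 0 A) :=
    NonUnitalStarAlgHom.codRestrict (κ.prod 0) _ fun _ =>
      (mem_pullback_restrictBoundary _ _).2 fun z => z.2.elim fun i => i.elim0
  refine ⟨StarAlgEquiv.ofBijective Φ ⟨fun a b h => ?_, ?_⟩⟩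
  · have h1 : κ a = κ b := congrArg (fun p => p.1.1) h
    exact DFunLike.congr_fun h1 default
  · rintro ⟨⟨w, x⟩, -⟩
    refine ⟨w default, Subtype.ext (Prod.ext ?_ (ContinuousMap.ext fun i => i.elim))⟩
    ext z
    exact congrArg w (Subsingleton.elim _ _)

/-- The `0`-skeleton of the cone over `A` is a copy of `A`, as the cone over the zero algebra is
zero. -/
theorem finiteDimensional_coneWithCell_zero (A : Type u) [NonUnitalCStarAlgebra A]
    (hA : FiniteDimensional ℂ A) :
    FiniteDimensional ℂ (ConeWithCell (0 : C(PEmpty.{u + 1}, A) →⋆ₙₐ[ℂ] SphereAlg 0 A)) := by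
  let L : ConeWithCell (0 : C(PEmpty.{u + 1}, A) →⋆ₙₐ[ℂ] SphereAlg 0 A) →ₗ[ℂ] A :=
    { toFun p := p.1.1 default
      map_add' _ _ := rfl
      map_smul' _ _ := rfl }
  have hL : Function.Injective L := fun p q h => by
    refine Subtype.ext (Prod.ext (ContinuousMap.ext fun z => ?_) ?_)
    · rw [Subsingleton.elim z default]
      exact h
    · ext t i
      exact i.elim
  exact Module.Finite.of_injective L hL

/-- The cone over `A` is obtained by attaching cells of dimension `n + 1` to an NCCW complex `E`
of dimension `n`, and evaluation at `1` factors through the restriction to `E`. -/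
def HasConeStructure (n : ℕ) (A : Type u) [NonUnitalCStarAlgebra A] : Prop :=
  ∃ (E : Type u) (_ : NonUnitalCStarAlgebra E) (F : Type u) (_ : NonUnitalCStarAlgebra F)
    (r : E →⋆ₙₐ[ℂ] SphereAlg (n + 1) F)
    (φ : Cone A ≃⋆ₐ[ℂ] pullback (restrictBoundary (n + 1) F) r) (q : E →⋆ₙₐ[ℂ] A),
    IsComplex n E ∧ FiniteDimensional ℂ F ∧ ∀ x, q (toSnd φ x) = Cone.evalOne A x

theorem hasConeStructure_of_equiv_pullback {k : ℕ} {A A' G : Type u} [NonUnitalCStarAlgebra A]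
    [NonUnitalCStarAlgebra A'] [NonUnitalCStarAlgebra G] {s : A' →⋆ₙₐ[ℂ] SphereAlg k G}
    (e : A ≃⋆ₐ[ℂ] pullback (restrictBoundary k G) s) (hE : IsComplex k (ConeWithCell s))
    (hG : FiniteDimensional ℂ G) : HasConeStructure k A :=
  ⟨ConeWithCell s, inferInstance, G, inferInstance, glue s, coneEquivPullback e,
    coneWithCellEval e, hE, hG, coneWithCellEval_coneToConeWithCell e⟩

theorem IsComplex.hasConeStructure (n : ℕ) :
    ∀ (A : Type u) [NonUnitalCStarAlgebra A], IsComplex n A → HasConeStructure n A := by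
  induction n with
  | zero =>
    intro A _ hA
    obtain ⟨e⟩ := nonempty_equiv_pullback_zero A
    exact hasConeStructure_of_equiv_pullback e (finiteDimensional_coneWithCell_zero A hA) hA
  | succ n ih =>
    rintro A _ ⟨A', _, G, _, s, hA', hG, ⟨e⟩⟩
    obtain ⟨E, _, F, _, r, φ, q, hE, hF, hq⟩ := ih A' hA'
    -- The cells of `A` and those of the cone over `A'` have the same dimension `n + 1`, and they
    -- are attached to `E` together, since `s` composed with evaluation at `1` factors through `E`.
    obtain ⟨ψ⟩ := nonempty_pullback_equiv_sphereProd φ (s.comp q) (s.comp (Cone.evalOne A'))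
      fun x => congrArg s (hq x).symm
    exact hasConeStructure_of_equiv_pullback e
      ⟨E, inferInstance, F × G, inferInstance, _, hE, inferInstance, ⟨ψ⟩⟩ hG

/-- The second coordinate of an element of the mapping cone is determined by the first one. -/
theorem nonempty_mappingCone_equiv_cone {A B : Type*} [NonUnitalCStarAlgebra A]
    [NonUnitalCStarAlgebra B] (f : A →⋆ₙₐ[ℂ] B) : Nonempty (MappingCone f ≃⋆ₐ[ℂ] Cone A) := by
  let Φ : MappingCone f →⋆ₙₐ[ℂ] Cone A :=
    (NonUnitalStarAlgHom.fst ℂ (Cone A) B).comp (NonUnitalStarSubalgebraClass.subtype _)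
  refine ⟨StarAlgEquiv.ofBijective Φ ⟨fun p q h => ?_, fun x => ⟨⟨(x, f (Cone.evalOne A x)), rfl⟩,
    rfl⟩⟩⟩
  have h' : p.1.1 = q.1.1 := h
  refine Subtype.ext (Prod.ext h' ?_)
  have hp : f (Cone.evalOne A p.1.1) = p.1.2 := p.2
  have hq : f (Cone.evalOne A q.1.1) = q.1.2 := q.2
  rw [← hp, ← hq, h']

end NCCW

theorem mainTheorem5 {A B : Type u} [NonUnitalCStarAlgebra A] [NonUnitalCStarAlgebra B]
    (f : A →⋆ₙₐ[ℂ] B) (hA : NCCW.AdmitsNCCW A) (hB : NCCW.AdmitsNCCW B) :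
    NCCW.AdmitsNCCW (NCCW.MappingCone f) := by
  obtain ⟨n, hA⟩ := hA
  obtain ⟨E, _, F, _, r, φ, -, hE, hF, -⟩ := NCCW.IsComplex.hasConeStructure n A hA
  obtain ⟨ψ⟩ := NCCW.nonempty_mappingCone_equiv_cone f
  exact ⟨n + 1, E, inferInstance, F, inferInstance, r, hE, hF, ⟨ψ.trans φ⟩⟩
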